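/- Let $(S,<)$ be a totally ordered set equipped with the structure of an abelian semigroup (no compatibility between the order and the multiplication is required), and let $\lambda\in\mathbb{Q}$. The mixable shuffle algebra Ш$_{\mathbb{Q},\lambda}(S)$ of weight $\lambda$ generated by the semigroup algebra $\mathbb{Q}S$ is the $\mathbb{Q}$-vector space $\bigoplus_{n\ge 0}(\mathbb{Q}S)^{\otimes n}$, with basis the set of words $s_1\otimes\cdots\otimes s_n$ ($n\ge 0$, $s_i\in S$), equipped with the bilinear product $\diamond$ for which the empty word $1$ is the unit and, for $a,b\in S$ and words $u,v$, $$(a\otimes u)\diamond(b\otimes v)=a\otimes\bigl(u\diamond(b\otimes v)\bigr)+b\otimes\bigl((a\otimes u)\diamond v\bigr)+\lambda\,(ab)\otimes(u\diamond v).$$ This is a commutative unitary $\mathbb{Q}$-algebra. Order the words lexicographically (a proper prefix of a word being smaller than the word), and let $\mathrm{Lyn}(S)$ be the set of Lyndon words, i.e. of non-empty words $w$ such that $w<v$ whenever $w=u\otimes v$ with $u,v$ non-empty words. Then Ш$_{\mathbb{Q},\lambda}(S)$ is isomorphic to the polynomial algebra $\mathbb{Q}[\mathrm{Lyn}(S)]$;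 more precisely, the $\mathbb{Q}$-algebra homomorphism from the polynomial ring in variables $X_w$, $w\in\mathrm{Lyn}(S)$, to Ш$_{\mathbb{Q},\lambda}(S)$ that sends $X_w$ to $w$ is an isomorphism. -/

import Mathlib

/-- A Lyndon word: a non-empty word `w` that is strictly smaller than `v` whenever `w = u ++ v` with
`u`, `v` non-empty. Words over `S` are lists, and `<` on `List S` is the lexicographic order induced
by the order on `S`, in which a proper prefix of a word is smaller than the word. -/
def IsLyndon {S : Type*} [LinearOrder S] (w : List S) : Prop :=
  w ≠ [] ∧ ∀ u v : List S, w = u ++ v → u ≠ [] → v ≠ [] → w < v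

/-- The set `Lyn(S)` of Lyndon words, as a type. -/
def Lyn (S : Type*) [LinearOrder S] : Type _ := {w : List S // IsLyndon w}

/-- The `k`-module underlying the mixable shuffle algebra of weight `lam` generated by the semigroup
algebra `k S`: it is the direct sum over `n ≥ 0` of the tensor powers of `k S`, that is, the free
`k`-module on the words over `S`, the word `[s₁, …, sₙ]` being the pure tensor `s₁ ⊗ ⋯ ⊗ sₙ`. -/
def MixableShuffle (k : Type*) [CommRing k] (_lam : k) (S : Type*) : Type _ := List S →₀ k

namespace MixableShuffle

noncomputable section

variable {k : Type*} [CommRing k] {lam : k} {S : Type*}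

instance : AddCommGroup (MixableShuffle k lam S) := inferInstanceAs (AddCommGroup (List S →₀ k))

instance : Module k (MixableShuffle k lam S) := inferInstanceAs (Module k (List S →₀ k))

/-- The basis element given by a word. -/
def word (lam : k) (w : List S) : MixableShuffle k lam S := Finsupp.single w (1 : k)

/-- The words as a basis of the mixable shuffle algebra. -/
def wordBasis (lam : k) (S : Type*) : Module.Basis (List S) k (MixableShuffle k lam S) :=
  Module.Basis.ofRepr (LinearEquiv.refl k (List S →₀ k))

/-- The linear map `x ↦ a ⊗ x`. -/
def cons (lam : k) (a : S) : MixableShuffle k lam S →ₗ[k] MixableShuffle k lam S :=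
  (wordBasis lam S).constr k fun w => word lam (a :: w)

/-- The mixable shuffle product of weight `lam` of two words:
`(a ⊗ u) ⋄ (b ⊗ v) = a ⊗ (u ⋄ (b ⊗ v)) + b ⊗ ((a ⊗ u) ⋄ v) + lam (ab) ⊗ (u ⋄ v)`,
the empty word being the unit. -/
def mulWord [Mul S] (lam : k) : List S → List S → MixableShuffle k lam S
  | [], v => word lam v
  | a :: u, [] => word lam (a :: u)
  | a :: u, b :: v =>
      cons lam a (mulWord lam u (b :: v)) + cons lam b (mulWord lam (a :: u) v)
        + lam • cons lam (a * b) (mulWord lam u v)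
  termination_by u v => u.length + v.length

/-- The mixable shuffle product of weight `lam`: the bilinear extension of `mulWord`. -/
def mulHom (lam : k) (S : Type*) [Mul S] :
    MixableShuffle k lam S →ₗ[k] MixableShuffle k lam S →ₗ[k] MixableShuffle k lam S :=
  (wordBasis lam S).constr k fun u => (wordBasis lam S).constr k fun v => mulWord lam u v

lemma wordBasis_apply (w : List S) : wordBasis lam S w = word lam w := rfl

lemma cons_word (a : S) (w : List S) : cons lam a (word lam w) = word lam (a :: w) := by
  rw [← wordBasis_apply, cons, Module.Basis.constr_basis]

lemma mulHom_word [Mul S] (u v : List S) :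
    mulHom lam S (word lam u) (word lam v) = mulWord lam u v := by
  rw [← wordBasis_apply u, ← wordBasis_apply v, mulHom, Module.Basis.constr_basis,
    Module.Basis.constr_basis]

lemma mulWord_nil [Mul S] (u : List S) : mulWord lam u [] = word lam u := by
  cases u <;> rw [mulWord]

lemma nil_mulHom [Mul S] (x : MixableShuffle k lam S) : mulHom lam S (word lam []) x = x := by
  have h : mulHom lam S (word lam []) = LinearMap.id := by
    refine (wordBasis lam S).ext fun v => ?_
    rw [wordBasis_apply, mulHom_word, mulWord, LinearMap.id_apply]
  rw [h, LinearMap.id_apply]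

lemma mulHom_nil [Mul S] (x : MixableShuffle k lam S) : mulHom lam S x (word lam []) = x := by
  have h : (mulHom lam S).flip (word lam []) = LinearMap.id := by
    refine (wordBasis lam S).ext fun v => ?_
    rw [wordBasis_apply, LinearMap.flip_apply, mulHom_word, mulWord_nil, LinearMap.id_apply]
  rw [← LinearMap.flip_apply, h, LinearMap.id_apply]

lemma mulHom_cons_cons [Mul S] (a b : S) (x y : MixableShuffle k lam S) :
    mulHom lam S (cons lam a x) (cons lam b y)
      = cons lam a (mulHom lam S x (cons lam b y)) + cons lam b (mulHom lam S (cons lam a x) y)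
        + lam • cons lam (a * b) (mulHom lam S x y) := by
  have h : (mulHom lam S).compl₁₂ (cons lam a) (cons lam b)
      = ((mulHom lam S).compl₂ (cons lam b)).compr₂ (cons lam a)
        + ((mulHom lam S).comp (cons lam a)).compr₂ (cons lam b)
        + lam • (mulHom lam S).compr₂ (cons lam (a * b)) := by
    refine (wordBasis lam S).ext fun u => (wordBasis lam S).ext fun v => ?_
    simp only [wordBasis_apply, LinearMap.compl₁₂_apply, LinearMap.add_apply, LinearMap.smul_apply,
      LinearMap.compr₂_apply, LinearMap.compl₂_apply, LinearMap.comp_apply, cons_word, mulHom_word]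
    rw [mulWord]
  exact LinearMap.congr_fun₂ h x y

lemma mulWord_comm [CommSemigroup S] (u v : List S) : mulWord lam u v = mulWord lam v u := by
  match u, v with
  | [], v => rw [mulWord_nil, mulWord]
  | a :: u, [] => rw [mulWord_nil, mulWord]
  | a :: u, b :: v =>
    rw [mulWord, mulWord, mulWord_comm u (b :: v), mulWord_comm (a :: u) v, mulWord_comm u v,
      mul_comm a b]
    abel
  termination_by u.length + v.length

lemma mulHom_comm [CommSemigroup S] (x y : MixableShuffle k lam S) :
    mulHom lam S x y = mulHom lam S y x := by
  have h : mulHom lam S = (mulHom lam S).flip := by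
    refine (wordBasis lam S).ext fun u => (wordBasis lam S).ext fun v => ?_
    simp only [wordBasis_apply, LinearMap.flip_apply, mulHom_word]
    exact mulWord_comm u v
  exact LinearMap.congr_fun₂ h x y

lemma word_assoc [Semigroup S] (u v w : List S) :
    mulHom lam S (mulHom lam S (word lam u) (word lam v)) (word lam w)
      = mulHom lam S (word lam u) (mulHom lam S (word lam v) (word lam w)) := by
  match u, v, w with
  | [], v, w => rw [nil_mulHom, nil_mulHom]
  | a :: u, [], w => rw [nil_mulHom, mulHom_nil]
  | a :: u, b :: v, [] => rw [mulHom_nil, mulHom_nil]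
  | a :: u, b :: v, d :: w =>
    have h1 := word_assoc u (b :: v) (d :: w)
    have h2 := word_assoc (a :: u) v (d :: w)
    have h3 := word_assoc (a :: u) (b :: v) w
    have h4 := word_assoc u v (d :: w)
    have h5 := word_assoc u (b :: v) w
    have h6 := word_assoc (a :: u) v w
    have h7 := word_assoc u v w
    have h8 := congrArg (cons lam d) h3
    simp only [← cons_word, mulHom_cons_cons, map_add, map_smul, LinearMap.add_apply,
      LinearMap.smul_apply, mul_assoc] at h1 h2 h4 h5 h6 h7 h8 ⊢
    simp only [h1, h2, h4, h5, h6, h7, map_add, map_smul]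
    linear_combination (norm := module) h8
  termination_by u.length + v.length + w.length

lemma mulHom_assoc [Semigroup S] (x y z : MixableShuffle k lam S) :
    mulHom lam S (mulHom lam S x y) z = mulHom lam S x (mulHom lam S y z) := by
  have hu (u v : List S) : mulHom lam S (mulHom lam S (word lam u) (word lam v))
      = (mulHom lam S (word lam u)).comp (mulHom lam S (word lam v)) :=
    (wordBasis lam S).ext fun w => word_assoc u v w
  have hv (u : List S) : (mulHom lam S).comp (mulHom lam S (word lam u))
      = (LinearMap.llcomp k _ _ _ (mulHom lam S (word lam u))).comp (mulHom lam S) :=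
    (wordBasis lam S).ext fun v => hu u v
  have hx : ((mulHom lam S).flip (mulHom lam S y z))
      = ((mulHom lam S).flip z).comp ((mulHom lam S).flip y) := by
    refine (wordBasis lam S).ext fun u => ?_
    exact (LinearMap.congr_fun₂ (hv u) y z).symm
  exact (LinearMap.congr_fun hx x).symm

/-- The mixable shuffle algebra is a commutative ring under the mixable shuffle product, with the
empty word as its unit. -/
instance [CommSemigroup S] : CommRing (MixableShuffle k lam S) where
  __ := (inferInstance : AddCommGroup (MixableShuffle k lam S))
  mul x y := mulHom lam S x y
  one := word lam []
  left_distrib x y z := map_add (mulHom lam S x) y z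
  right_distrib x y z := LinearMap.map_add₂ (mulHom lam S) x y z
  zero_mul x := LinearMap.map_zero₂ (mulHom lam S) x
  mul_zero x := map_zero (mulHom lam S x)
  mul_assoc x y z := mulHom_assoc x y z
  one_mul x := nil_mulHom x
  mul_one x := mulHom_nil x
  mul_comm x y := mulHom_comm x y

instance [CommSemigroup S] : Algebra k (MixableShuffle k lam S) :=
  Algebra.ofModule (fun r x y => LinearMap.map_smul₂ (mulHom lam S) r x y)
    (fun r x y => map_smul (mulHom lam S x) r y)

lemma word_mul_word [CommSemigroup S] (u v : List S) :
    word lam u * word lam v = mulWord lam u v := mulHom_word u v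

end

end MixableShuffle

/-!
The proof is a triangularity argument with respect to the basis of words.

By the Chen-Fox-Lyndon theorem (`exists_lyndon_factorization`, `lyndon_factorization_unique`) every
word is the concatenation of a unique non-increasing list of Lyndon words, so that monomials in the
variables `X_w` correspond bijectively to words (`bijective_flatten_monomialFactors`). The image of
a monomial is the mixable shuffle product of its Lyndon factors `l₁ ≥ ⋯ ≥ lₙ`, and its leading word
is `l₁ ⋯ lₙ` (`MixableShuffle.leading_word_prod`): this word has a positive coefficient, and every
other word that occurs is shorter or is a lexicographically smaller rearrangement. The terms with a
factor `λ` contribute only shorter words, so they do not affect the leading word. As a word has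
finitely many rearrangements, the words are ranked by pairs of natural numbers
(`MixableShuffle.wordRank`), and triangularity with respect to this well-founded rank gives
bijectivity (`LinearMap.bijective_of_triangular`), even though the order on `S` need not be
well-founded.

The combinatorial core is `IsLyndon.shuffle_le`: if `l` is a Lyndon word and `w` is a product of
words that are at most `l`, then `l ++ w` is the largest shuffle of `l` and `w`. Only finitely many
letters matter, so the lexicographic order on words of a given length can be encoded by a
discounted sum `∑ f(sᵢ) βⁱ`. Shift `f` by the constant for which the sum of `l` is `0`. As `l` is
Lyndon, every word `p ≤ l` then has a non-positive sum, in particular every prefix of `l`, and hence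
so does every prefix of `w`. Summation by parts along a shuffle (`IsShuffle.discSum_le`) shows that
postponing letters of `l` in favour of letters of `w` does not increase the discounted sum.
-/

/-! ### Lexicographic order and Lyndon words -/

section Words

variable {S : Type*} [LinearOrder S]

lemma List.lt_append_of_ne_nil (u : List S) {v : List S} (hv : v ≠ []) : u < u ++ v := by
  induction u with
  | nil => cases v with
    | nil => exact absurd rfl hv
    | cons a v => exact List.nil_lt_cons a v
  | cons a u ih => simpa [List.cons_lt_cons_iff] using ih

lemma List.le_of_prefix {u v : List S} (h : u <+: v) : u ≤ v := by
  obtain ⟨t, rfl⟩ := h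
  rcases eq_or_ne t [] with rfl | ht
  · simp
  · exact (List.lt_append_of_ne_nil u ht).le

lemma List.append_lt_append_left_iff (u : List S) {v w : List S} :
    u ++ v < u ++ w ↔ v < w := by
  induction u with
  | nil => rfl
  | cons a u ih => simpa [List.cons_lt_cons_iff] using ih

/-- If `p < q` and `p` is not a prefix of `q`, the two words differ at some letter, so the
inequality persists whatever is appended to them. -/
lemma List.append_lt_append_of_not_prefix {p q : List S} (h : p < q) (hp : ¬ p <+: q)
    (x y : List S) : p ++ x < q ++ y := by
  induction p generalizing q with
  | nil => exact absurd (List.nil_prefix) hp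
  | cons a p ih =>
    cases q with
    | nil => exact absurd h (List.not_lt_nil _)
    | cons b q =>
      rw [List.cons_lt_cons_iff] at h
      simp only [List.cons_append, List.cons_lt_cons_iff]
      rcases h with h | ⟨rfl, h⟩
      · exact Or.inl h
      · exact Or.inr ⟨rfl, ih h fun h' => hp ((List.prefix_cons_inj a).2 h')⟩

/-- A Lyndon word and a proper suffix of it differ at some letter, since the suffix is larger and too
short to have the Lyndon word as a prefix. -/
lemma IsLyndon.lt_of_suffix {u s : List S} {l : List S} (hl : IsLyndon l) (h : l = u ++ s)
    (hu : u ≠ []) (hs : s ≠ []) (x y : List S) : l ++ x < s ++ y := by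
  refine List.append_lt_append_of_not_prefix (hl.2 u s h hu hs) (fun hp => ?_) x y
  have h1 := hp.length_le
  have h2 := List.length_pos_iff.2 hu
  rw [h, List.length_append] at h1
  omega

lemma isLyndon_singleton (a : S) : IsLyndon [a] := by
  refine ⟨by simp, fun u v h hu hv => absurd (congrArg List.length h) ?_⟩
  have h1 := List.length_pos_iff.2 hu
  have h2 := List.length_pos_iff.2 hv
  simp only [List.length_append, List.length_singleton]
  omega

lemma IsLyndon.append {u v : List S} (hu : IsLyndon u) (hv : IsLyndon v) (h : u < v) :
    IsLyndon (u ++ v) := by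
  have huv : u ++ v < v := by
    by_cases hp : u <+: v
    · obtain ⟨t, rfl⟩ := hp
      refine (List.append_lt_append_left_iff u).2 (hv.2 u t rfl hu.1 ?_)
      rintro rfl
      simp at h
    · simpa using List.append_lt_append_of_not_prefix h hp v []
  refine ⟨by simp [hu.1], fun p s hps hp hs => ?_⟩
  rcases List.append_eq_append_iff.1 hps with ⟨t, rfl, ht⟩ | ⟨t, hut, rfl⟩
  · rcases eq_or_ne t [] with rfl | ht0
    · simp only [List.nil_append] at ht
      exact ht ▸ huv
    · exact huv.trans (hv.2 t s ht ht0 hs)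
  · rcases eq_or_ne t [] with rfl | ht0
    · simpa using huv
    · exact hu.lt_of_suffix hut hp ht0 v v

/-- Existence in the Chen-Fox-Lyndon theorem, inductive step: a Lyndon word is put in front of a
non-increasing product by merging it with the leading factors that are larger than it. -/
lemma IsLyndon.exists_flatten_eq_append {l : List S} (hl : IsLyndon l) {L : List (List S)}
    (hL : ∀ m ∈ L, IsLyndon m) (hs : L.Pairwise (· ≥ ·)) :
    ∃ L' : List (List S), (∀ m ∈ L', IsLyndon m) ∧ L'.Pairwise (· ≥ ·) ∧
      L'.flatten = l ++ L.flatten := by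
  induction L generalizing l with
  | nil => exact ⟨[l], by simpa using hl, by simp, by simp⟩
  | cons m L ih =>
    have hm := hL m (by simp)
    have hL' : ∀ n ∈ L, IsLyndon n := fun n hn => hL n (by simp [hn])
    rw [List.pairwise_cons] at hs
    rcases lt_or_ge l m with h | h
    · obtain ⟨L', h1, h2, h3⟩ := ih (hl.append hm h) hL' hs.2
      exact ⟨L', h1, h2, by simp [h3]⟩
    · refine ⟨l :: m :: L, by simpa [hl] using hL, ?_, by simp⟩
      rw [List.pairwise_cons, List.pairwise_cons]
      refine ⟨fun n hn => ?_, hs⟩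
      rcases List.mem_cons.1 hn with rfl | hn
      · exact h
      · exact (hs.1 n hn).trans h

/-- Existence in the Chen-Fox-Lyndon theorem. -/
theorem exists_lyndon_factorization (w : List S) :
    ∃ L : List (List S), (∀ m ∈ L, IsLyndon m) ∧ L.Pairwise (· ≥ ·) ∧ L.flatten = w := by
  induction w with
  | nil => exact ⟨[], by simp, by simp, rfl⟩
  | cons a w ih =>
    obtain ⟨L, h1, h2, rfl⟩ := ih
    exact (isLyndon_singleton a).exists_flatten_eq_append h1 h2

/-- In a product of Lyndon words that are all `≥ l`, every non-empty suffix is `≥ l`. -/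
lemma le_suffix_of_lyndon_factors {l : List S} {L : List (List S)}
    (hL : ∀ m ∈ L, IsLyndon m) (hl : ∀ m ∈ L, l ≤ m) {u s : List S} (h : L.flatten = u ++ s)
    (hs : s ≠ []) : l ≤ s := by
  induction L generalizing u with
  | nil =>
    have := List.append_eq_nil_iff.1 h.symm
    exact absurd this.2 hs
  | cons m L ih =>
    have hL' : ∀ n ∈ L, IsLyndon n := fun n hn => hL n (by simp [hn])
    have hl' : ∀ n ∈ L, l ≤ n := fun n hn => hl n (by simp [hn])
    rw [List.flatten_cons] at h
    rcases List.append_eq_append_iff.1 h with ⟨t, rfl, ht⟩ | ⟨t, hm, rfl⟩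
    · exact ih hL' hl' ht
    · rcases eq_or_ne t [] with rfl | ht
      · exact ih hL' hl' (u := []) (by simp)
      · refine (hl m (by simp)).trans (le_trans ?_ (List.le_of_prefix (List.prefix_append t _)))
        rcases eq_or_ne u [] with rfl | hu
        · simp [hm]
        · exact ((hL m (by simp)).2 u t hm hu ht).le

/-- Uniqueness in the Chen-Fox-Lyndon theorem: the last factor is the smallest non-empty suffix. -/
theorem lyndon_factorization_unique {L M : List (List S)}
    (hL : ∀ m ∈ L, IsLyndon m) (hLs : L.Pairwise (· ≥ ·))
    (hM : ∀ m ∈ M, IsLyndon m) (hMs : M.Pairwise (· ≥ ·)) (h : L.flatten = M.flatten) :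
    L = M := by
  induction L using List.reverseRecOn generalizing M with
  | nil =>
    cases M with
    | nil => rfl
    | cons m M =>
      rw [List.flatten_nil, List.flatten_cons] at h
      exact absurd (List.append_eq_nil_iff.1 h.symm).1 (hM m (by simp)).1
  | append_singleton L l ih =>
    rcases List.eq_nil_or_concat' M with rfl | ⟨M, m, rfl⟩
    · simp only [List.flatten_append, List.flatten_nil, List.append_eq_nil_iff] at h
      simp only [List.flatten_cons, List.flatten_nil, List.append_nil] at h
      exact absurd h.2 (hL l (by simp)).1
    · have last_le {K : List (List S)} {a : List S} (hK : (K ++ [a]).Pairwise (· ≥ ·)) :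
          ∀ n ∈ K ++ [a], a ≤ n := by
        intro n hn
        rcases List.mem_append.1 hn with hn | hn
        · exact (List.pairwise_append.1 hK).2.2 n hn a (by simp)
        · simp_all
      have hl := hL l (by simp)
      have hm := hM m (by simp)
      have hlm : l = m := le_antisymm
        (le_suffix_of_lyndon_factors hL (last_le hLs) (u := M.flatten) (by simp [h]) hm.1)
        (le_suffix_of_lyndon_factors hM (last_le hMs) (u := L.flatten) (by simp [← h]) hl.1)
      subst hlm
      have h' : L.flatten = M.flatten := by simpa using h
      rw [ih (fun n hn => hL n (by simp [hn])) (List.pairwise_append.1 hLs).1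
        (fun n hn => hM n (by simp [hn])) (List.pairwise_append.1 hMs).1 h']

end Words

/-! ### Shuffles of two words -/

/-- `IsShuffle u v x`: the word `x` arises by interleaving the letters of `u` and `v`. -/
inductive IsShuffle {S : Type*} : List S → List S → List S → Prop
  | nil : IsShuffle [] [] []
  | left (a : S) {u v x : List S} : IsShuffle u v x → IsShuffle (a :: u) v (a :: x)
  | right (b : S) {u v x : List S} : IsShuffle u v x → IsShuffle u (b :: v) (b :: x)

namespace IsShuffle

variable {S : Type*}

lemma perm {u v x : List S} (h : IsShuffle u v x) : x.Perm (u ++ v) := by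
  induction h with
  | nil => rfl
  | left a _ ih => exact ih.cons a
  | right b _ ih => exact (ih.cons b).trans List.perm_middle.symm

lemma nil_left (v : List S) : IsShuffle [] v v := by
  induction v with
  | nil => exact .nil
  | cons b v ih => exact .right b ih

lemma append (u v : List S) : IsShuffle u v (u ++ v) := by
  induction u with
  | nil => exact nil_left v
  | cons a u ih => exact .left a ih

/-- Increasing the second word increases some shuffle obtained from the same interleaving. -/
lemma exists_gt [LinearOrder S] {u v w x : List S} (h : IsShuffle u v x)
    (hlen : w.length = v.length) (hvw : v < w) : ∃ y, IsShuffle u w y ∧ x < y := by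
  induction h generalizing w with
  | nil => simp_all
  | left a h ih =>
    obtain ⟨y, hy, hxy⟩ := ih hlen hvw
    exact ⟨a :: y, hy.left a, List.cons_lt_cons_iff.2 (Or.inr ⟨rfl, hxy⟩)⟩
  | right b h ih =>
    cases w with
    | nil => simp at hlen
    | cons c w =>
      rcases List.cons_lt_cons_iff.1 hvw with hbc | ⟨rfl, hlt⟩
      · exact ⟨_, (append _ w).right c, List.cons_lt_cons_iff.2 (Or.inl hbc)⟩
      · obtain ⟨y, hy, hxy⟩ := ih (by simpa using hlen) hlt
        exact ⟨b :: y, hy.right b, List.cons_lt_cons_iff.2 (Or.inr ⟨rfl, hxy⟩)⟩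

end IsShuffle

/-! ### Discounted sums of letters -/

section DiscSum

variable {S : Type*}

/-- The sum `∑ᵢ f(sᵢ) βⁱ` over the letters of a word `s₀ s₁ ⋯`. For a suitable `f` and a small
`β` it encodes the lexicographic order on words of equal length. -/
def discSum (f : S → ℚ) (β : ℚ) : List S → ℚ
  | [] => 0
  | a :: w => f a + β * discSum f β w

lemma discSum_append (f : S → ℚ) (β : ℚ) (u v : List S) :
    discSum f β (u ++ v) = discSum f β u + β ^ u.length * discSum f β v := by
  induction u with
  | nil => simp [discSum]
  | cons a u ih => simp only [List.cons_append, discSum, ih, List.length_cons]; ring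

lemma discSum_sub_const (f : S → ℚ) (r β : ℚ) (w : List S) :
    discSum (fun a => f a - r) β w
      = discSum f β w - r * ∑ i ∈ Finset.range w.length, β ^ i := by
  induction w with
  | nil => simp [discSum]
  | cons a w ih =>
    simp only [discSum, ih, List.length_cons, Finset.sum_range_succ', pow_succ, ← Finset.sum_mul]
    ring

/-- Summation by parts for shuffles. Let `P` and `Q` stand for the discounted sums of letters of the
two words already read, rescaled so that the next letters have weight `1`. If all the partial sums
that continue `P` along `u`, and `Q` along `v`, are non-positive and those of `u` end at `0`, then
no shuffle has a larger discounted sum than reading first `u` and then `v`. -/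
lemma IsShuffle.discSum_le {f : S → ℚ} {β : ℚ} (hβ : 0 < β) (hβ1 : β ≤ 1) {u v x : List S}
    (h : IsShuffle u v x) {P Q : ℚ}
    (hP : ∀ p, p <+: u → P + discSum f β p ≤ 0) (hPu : P + discSum f β u = 0)
    (hQ : ∀ q, q <+: v → Q + discSum f β q ≤ 0) :
    P + Q + discSum f β x ≤ β ^ u.length * (Q + discSum f β v) := by
  have step {c a y : ℚ} : (c + a) / β + y = (c + (a + β * y)) / β := by field_simp; ring
  induction h generalizing P Q with
  | nil => simp only [discSum, List.length_nil] at *; linarith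
  | @left a u v x h ih =>
    have hQ0 : Q ≤ 0 := by simpa [discSum] using hQ [] (List.nil_prefix)
    have := ih (P := (P + f a) / β) (Q := Q)
      (fun p hp => by
        rw [step]
        exact div_nonpos_of_nonpos_of_nonneg
          (hP (a :: p) ((List.prefix_cons_inj a).2 hp)) hβ.le)
      (by rw [step]; simp only [discSum] at hPu; rw [hPu, zero_div]) hQ
    have h2 := mul_le_mul_of_nonneg_left this hβ.le
    have h3 : β * ((P + f a) / β) = P + f a := mul_div_cancel₀ _ hβ.ne'
    -- reading a letter of `u` discounts the non-positive sum `Q`, which can only raise it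
    have h4 : Q ≤ β * Q := by nlinarith
    simp only [discSum, List.length_cons, pow_succ]
    linear_combination h2 + h4 - h3
  | @right b u v x h ih =>
    have hP0 : P ≤ 0 := by simpa [discSum] using hP [] (List.nil_prefix)
    have := ih (P := P) (Q := (Q + f b) / β) hP hPu
      (fun p hp => by
        rw [step]
        exact div_nonpos_of_nonpos_of_nonneg
          (hQ (b :: p) ((List.prefix_cons_inj b).2 hp)) hβ.le)
    have h2 := mul_le_mul_of_nonneg_left this hβ.le
    have h3 : β * ((Q + f b) / β) = Q + f b := mul_div_cancel₀ _ hβ.ne'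
    have h4 : P ≤ β * P := by nlinarith
    simp only [discSum]
    linear_combination h2 + h4 - (1 - β ^ u.length) * h3

variable [LinearOrder S]

/-- On a finite alphabet, a suitable discounted sum encodes the lexicographic order. -/
lemma exists_discSum_lt (A : Finset S) : ∃ (f : S → ℚ) (β : ℚ), 0 < β ∧ β < 1 ∧
    ∀ x y : List S, x.length = y.length → (∀ a ∈ x, a ∈ A) → (∀ a ∈ y, a ∈ A) → x < y →
      discSum f β x < discSum f β y := by
  obtain ⟨N, hNA⟩ : ∃ N : ℚ, N = (A.card : ℚ) := ⟨_, rfl⟩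
  have hN : 0 ≤ N := hNA ▸ Nat.cast_nonneg _
  let f : S → ℚ := fun a => ((A.filter (· < a)).card : ℚ)
  have hf (a : S) : 0 ≤ f a ∧ f a ≤ N :=
    ⟨Nat.cast_nonneg _, hNA ▸ Nat.cast_le.2 (Finset.card_filter_le _ _)⟩
  have hlt {a b : S} (ha : a ∈ A) (hab : a < b) : f a + 1 ≤ f b := by
    have : (A.filter (· < a)).card < (A.filter (· < b)).card := by
      refine Finset.card_lt_card (Finset.ssubset_iff_of_subset ?_ |>.2 ⟨a, ?_, ?_⟩)
      · exact fun c hc => by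
          simp only [Finset.mem_filter] at hc ⊢
          exact ⟨hc.1, hc.2.trans hab⟩
      · simp [ha, hab]
      · simp
    simp only [f]
    exact_mod_cast this
  obtain ⟨β, hβ⟩ : ∃ β : ℚ, β = 1 / (N + 2) := ⟨_, rfl⟩
  have hβ0 : 0 < β := by rw [hβ]; positivity
  have hβ2 : β * (N + 2) = 1 := by rw [hβ]; field_simp
  have bound (w : List S) : 0 ≤ discSum f β w ∧ discSum f β w ≤ N + 1 := by
    induction w with
    | nil => simp only [discSum]; constructor <;> linarith
    | cons a w ih =>
      have h1 := mul_le_mul_of_nonneg_left ih.2 hβ0.le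
      have h2 := mul_nonneg hβ0.le ih.1
      have := hf a
      simp only [discSum]
      constructor <;> linarith
  refine ⟨f, β, hβ0, by nlinarith, fun x => ?_⟩
  induction x with
  | nil =>
    intro y hxy _ _ h
    cases y with
    | nil => simp at h
    | cons b y => simp at hxy
  | cons a x ih =>
    intro y hxy hx hy h
    cases y with
    | nil => simp at hxy
    | cons b y =>
      simp only [discSum]
      rcases List.cons_lt_cons_iff.1 h with hab | ⟨rfl, hlex⟩
      · have h1 := hlt (hx a (by simp)) hab
        have h2 := mul_le_mul_of_nonneg_left (bound x).2 hβ0.le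
        have h3 := mul_nonneg hβ0.le (bound y).1
        linarith
      · have := ih y (by simpa using hxy) (fun c hc => hx c (by simp [hc]))
          (fun c hc => hy c (by simp [hc])) hlex
        have := mul_lt_mul_of_pos_left this hβ0
        linarith

/-- The word `l ++ w` is the largest shuffle of a Lyndon word `l` with a product `w` of words that
are at most `l`. -/
theorem IsLyndon.shuffle_le {l : List S} (hl : IsLyndon l) {L : List (List S)}
    (hL : ∀ m ∈ L, m ≤ l) {x : List S} (hx : IsShuffle l L.flatten x) :
    x ≤ l ++ L.flatten := by
  set A : Finset S := (l ++ L.flatten).toFinset with hA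
  have hlA : ∀ a ∈ l, a ∈ A := fun a ha => by simp [hA, ha]
  have hLA : ∀ m ∈ L, ∀ a ∈ m, a ∈ A := fun m hm a ha => by
    simp only [hA, List.toFinset_append, Finset.mem_union, List.mem_toFinset, List.mem_flatten]
    exact Or.inr ⟨m, hm, ha⟩
  obtain ⟨f, β, hβ, hβ1, hlex⟩ := exists_discSum_lt A
  -- the letters are shifted by a constant so that `l` gets the discounted sum `0`
  set G : ℚ := ∑ i ∈ Finset.range l.length, β ^ i
  have hlpos := List.length_pos_iff.2 hl.1
  have hG : 0 < G := Finset.sum_pos (fun i _ => pow_pos hβ i) (by simpa using hlpos.ne')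
  set g : S → ℚ := fun a => f a - discSum f β l / G with hg
  have hgl : discSum g β l = 0 := by
    rw [hg, discSum_sub_const, div_mul_cancel₀ _ hG.ne', sub_self]
  have hlex' : ∀ x y : List S, x.length = y.length → (∀ a ∈ x, a ∈ A) → (∀ a ∈ y, a ∈ A) →
      x < y → discSum g β x < discSum g β y := by
    intro x y hxy hxA hyA h
    rw [hg, discSum_sub_const, discSum_sub_const, hxy]
    exact sub_lt_sub_right (hlex x y hxy hxA hyA h) _
  have hpow : β ^ l.length < 1 := pow_lt_one₀ hβ.le hβ1 hlpos.ne'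
  -- the sign of the discounted sum of `p` is decided by comparing `p ++ l` with `l ++ p`
  have sign_neg {p : List S} (hp : ∀ a ∈ p, a ∈ A) (h : p ++ l < l ++ p) :
      discSum g β p ≤ 0 := by
    have := hlex' _ _ (by simp [add_comm])
      (fun a ha => (List.mem_append.1 ha).elim (hp a) (hlA a))
      (fun a ha => (List.mem_append.1 ha).elim (hlA a) (hp a)) h
    rw [discSum_append, discSum_append, hgl] at this
    nlinarith
  have sign_pos {p : List S} (hp : ∀ a ∈ p, a ∈ A) (h : l ++ p < p ++ l) :
      0 ≤ discSum g β p := by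
    have := hlex' _ _ (by simp [add_comm])
      (fun a ha => (List.mem_append.1 ha).elim (hlA a) (hp a))
      (fun a ha => (List.mem_append.1 ha).elim (hp a) (hlA a)) h
    rw [discSum_append, discSum_append, hgl] at this
    nlinarith
  have neg_of_le {p : List S} (hp : ∀ a ∈ p, a ∈ A) (hpl : p ≤ l) : discSum g β p ≤ 0 := by
    by_cases h : p <+: l
    · obtain ⟨s, hs⟩ := h
      rcases eq_or_ne p [] with rfl | hp0
      · simp [discSum]
      rcases eq_or_ne s [] with rfl | hs0
      · rw [List.append_nil] at hs
        rw [hs, hgl]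
      have h1 : 0 ≤ discSum g β s :=
        sign_pos (fun a ha => hlA a (by simp [← hs, ha])) (hl.lt_of_suffix hs.symm hp0 hs0 _ _)
      have h2 := hgl
      rw [← hs, discSum_append] at h2
      have := mul_nonneg (pow_pos hβ p.length).le h1
      linarith
    · refine sign_neg hp (List.append_lt_append_of_not_prefix (lt_of_le_of_ne hpl ?_) h _ _)
      rintro rfl
      exact h List.prefix_rfl
  -- a prefix of a product consists of some of the factors and a prefix of the next one
  have prefix_neg : ∀ K : List (List S), (∀ m ∈ K, m ∈ L) → ∀ q, q <+: K.flatten →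
      discSum g β q ≤ 0 := by
    intro K
    induction K with
    | nil =>
      intro _ q hq
      rw [List.flatten_nil, List.prefix_nil] at hq
      simp [hq, discSum]
    | cons m K ih =>
      intro hK q hq
      have hm := hK m (by simp)
      obtain ⟨r, hr⟩ := hq
      rw [List.flatten_cons] at hr
      rcases List.append_eq_append_iff.1 hr with ⟨t, ht, -⟩ | ⟨t, rfl, ht⟩
      · have hqm : q <+: m := ⟨t, ht.symm⟩
        exact neg_of_le (fun a ha => hLA m hm a (hqm.subset ha))
          ((List.le_of_prefix hqm).trans (hL m hm))
      · rw [discSum_append]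
        have h1 := neg_of_le (hLA m hm) (hL m hm)
        have h2 := ih (fun n hn => hK n (by simp [hn])) t ⟨r, ht.symm⟩
        have := mul_nonpos_of_nonneg_of_nonpos (pow_pos hβ m.length).le h2
        linarith
  have key := hx.discSum_le (f := g) hβ hβ1.le (P := 0) (Q := 0)
    (fun p hp => by
      rw [zero_add]
      exact neg_of_le (fun a ha => hlA a (hp.subset ha)) (List.le_of_prefix hp))
    (by rw [hgl, zero_add])
    (fun q hq => by rw [zero_add]; exact prefix_neg L (fun _ h => h) q hq)
  by_contra hlt
  have := hlex' _ _ (by rw [hx.perm.length_eq]) (fun a ha => by rwa [hA, List.mem_toFinset])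
    (fun a ha => by rw [hA, List.mem_toFinset]; exact hx.perm.subset ha) (not_le.1 hlt)
  rw [discSum_append, hgl] at this
  linarith

end DiscSum

/-! ### Triangular linear maps -/

section Triangular

variable {k M N I J R : Type*} [Field k] [AddCommGroup M] [Module k M] [AddCommGroup N]
  [Module k N] [LinearOrder R]

/-- A linear map that is triangular, with non-zero diagonal entries, with respect to a bijection of
the bases and a well-founded rank on the basis of the target is bijective. -/
theorem LinearMap.bijective_of_triangular [WellFoundedLT R] (b : Module.Basis I k M)
    (c : Module.Basis J k N) (f : M →ₗ[k] N) (W : I → J) (hW : Function.Bijective W) (rank : J → R)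
    (hdiag : ∀ i, c.repr (f (b i)) (W i) ≠ 0)
    (hlow : ∀ i j, c.repr (f (b i)) j ≠ 0 → j = W i ∨ rank j < rank (W i)) :
    Function.Bijective f := by
  constructor
  · rw [← LinearMap.ker_eq_bot, LinearMap.ker_eq_bot']
    intro x hx
    by_contra hx0
    have hsupp : (b.repr x).support.Nonempty := by
      rw [Finsupp.support_nonempty_iff]
      simpa using hx0
    -- an index in the support with the largest leading term contributes it alone
    obtain ⟨i, hi, hmax⟩ := Finset.exists_max_image _ (fun i => rank (W i)) hsupp
    have hcoef : c.repr (f x) (W i) = b.repr x i * c.repr (f (b i)) (W i) := by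
      conv_lhs => rw [← b.linearCombination_repr x]
      rw [Finsupp.linearCombination_apply, Finsupp.sum, map_sum, map_sum, Finsupp.finsetSum_apply,
        Finset.sum_eq_single_of_mem i hi]
      · simp
      · intro i' hi' hne
        simp only [map_smul, Finsupp.smul_apply, smul_eq_mul, mul_eq_zero]
        right
        by_contra h
        rcases hlow i' _ h with h | h
        · exact hne (hW.1 h).symm
        · exact absurd (hmax i' hi') (not_le.2 h)
    rw [hx] at hcoef
    simp only [map_zero, Finsupp.coe_zero, Pi.zero_apply] at hcoef
    exact mul_ne_zero (Finsupp.mem_support_iff.1 hi) (hdiag i) hcoef.symm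
  · classical
    rw [← LinearMap.range_eq_top, ← top_le_iff, ← c.span_eq, Submodule.span_le]
    have (r : R) : ∀ j, rank j = r → c j ∈ LinearMap.range f := by
      induction r using WellFoundedLT.induction with
      | ind r ih =>
        rintro j rfl
        obtain ⟨i, rfl⟩ := hW.2 j
        have hsum := c.linearCombination_repr (f (b i))
        rw [Finsupp.linearCombination_apply, Finsupp.sum,
          ← Finset.add_sum_erase _ _ (Finsupp.mem_support_iff.2 (hdiag i))] at hsum
        have hrest : ∑ j ∈ (c.repr (f (b i))).support.erase (W i), c.repr (f (b i)) j • c j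
            ∈ LinearMap.range f := by
          refine Submodule.sum_mem _ fun j hj => Submodule.smul_mem _ _ ?_
          rw [Finset.mem_erase, Finsupp.mem_support_iff] at hj
          exact ih _ ((hlow i j hj.2).resolve_left hj.1) j rfl
        have hlead := Submodule.sub_mem _ (LinearMap.mem_range_self f (b i)) hrest
        rw [← eq_sub_of_add_eq hsum] at hlead
        exact (Submodule.smul_mem_iff _ (hdiag i)).1 hlead
    rintro _ ⟨j, rfl⟩
    exact this _ j rfl

end Triangular

/-! ### Leading words of mixable shuffle products -/

namespace MixableShuffle

section Coefficients

variable {k : Type*} [CommRing k] {lam : k} {S : Type*}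

lemma repr_word (w : List S) :
    (wordBasis lam S).repr (word lam w) = Finsupp.single w (1 : k) := by
  rw [← wordBasis_apply, Module.Basis.repr_self]

lemma repr_cons_nil (a : S) (x : MixableShuffle k lam S) :
    (wordBasis lam S).repr (cons lam a x) [] = 0 := by
  have : (wordBasis lam S).coord [] ∘ₗ cons lam a = 0 :=
    (wordBasis lam S).ext fun w => by
      simp [wordBasis_apply, cons_word, repr_word]
  exact LinearMap.congr_fun this x

lemma repr_cons_cons_self (a : S) (x : MixableShuffle k lam S) (w : List S) :
    (wordBasis lam S).repr (cons lam a x) (a :: w) = (wordBasis lam S).repr x w := by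
  have : (wordBasis lam S).coord (a :: w) ∘ₗ cons lam a = (wordBasis lam S).coord w :=
    (wordBasis lam S).ext fun v => by
      classical
      simp only [LinearMap.comp_apply, wordBasis_apply, cons_word, Module.Basis.coord_apply,
        repr_word, Finsupp.single_apply, List.cons_inj_right]
  exact LinearMap.congr_fun this x

lemma repr_cons_cons_of_ne {a b : S} (h : a ≠ b) (x : MixableShuffle k lam S) (w : List S) :
    (wordBasis lam S).repr (cons lam a x) (b :: w) = 0 := by
  have : (wordBasis lam S).coord (b :: w) ∘ₗ cons lam a = 0 :=
    (wordBasis lam S).ext fun v => by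
      simp [wordBasis_apply, cons_word, repr_word, h]
  exact LinearMap.congr_fun this x

lemma exists_of_repr_cons_ne_zero {a : S} {x : MixableShuffle k lam S} {z : List S}
    (h : (wordBasis lam S).repr (cons lam a x) z ≠ 0) :
    ∃ w, z = a :: w ∧ (wordBasis lam S).repr x w ≠ 0 := by
  cases z with
  | nil => exact absurd (repr_cons_nil a x) h
  | cons b w =>
    by_cases hab : a = b
    · subst hab
      exact ⟨w, rfl, by rwa [repr_cons_cons_self] at h⟩
    · exact absurd (repr_cons_cons_of_ne hab x w) h

/-- The words in a mixable shuffle product are shuffles or shorter words. -/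
lemma isShuffle_or_length_lt_of_repr_ne_zero [Mul S] {u v z : List S}
    (h : (wordBasis lam S).repr (mulWord lam u v) z ≠ 0) :
    IsShuffle u v z ∨ z.length < u.length + v.length := by
  match u, v with
  | [], v =>
    rw [mulWord, repr_word, Finsupp.single_apply_ne_zero] at h
    exact Or.inl (h.1 ▸ IsShuffle.nil_left v)
  | a :: u, [] =>
    rw [mulWord, repr_word, Finsupp.single_apply_ne_zero] at h
    exact Or.inl (by simpa [h.1] using IsShuffle.append (a :: u) [])
  | a :: u, b :: v =>
    rw [mulWord] at h
    simp only [map_add, map_smul, Finsupp.add_apply, Finsupp.smul_apply] at h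
    by_cases h1 : (wordBasis lam S).repr (cons lam a (mulWord lam u (b :: v))) z = 0
    · by_cases h2 : (wordBasis lam S).repr (cons lam b (mulWord lam (a :: u) v)) z = 0
      · rw [h1, h2, zero_add, zero_add] at h
        obtain ⟨w, rfl, hw⟩ := exists_of_repr_cons_ne_zero (right_ne_zero_of_smul h)
        right
        have : w.length ≤ u.length + v.length := by
          rcases isShuffle_or_length_lt_of_repr_ne_zero hw with hw | hw
          · simp [hw.perm.length_eq]
          · exact hw.le
        simp only [List.length_cons]
        omega
      · obtain ⟨w, rfl, hw⟩ := exists_of_repr_cons_ne_zero h2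
        refine (isShuffle_or_length_lt_of_repr_ne_zero hw).imp (fun h => h.right b) fun h => ?_
        simp only [List.length_cons] at h ⊢
        omega
    · obtain ⟨w, rfl, hw⟩ := exists_of_repr_cons_ne_zero h1
      refine (isShuffle_or_length_lt_of_repr_ne_zero hw).imp (fun h => h.left a) fun h => ?_
      simp only [List.length_cons] at h ⊢
      omega
  termination_by u.length + v.length

lemma length_le_of_repr_ne_zero [Mul S] {u v z : List S}
    (h : (wordBasis lam S).repr (mulWord lam u v) z ≠ 0) :
    z.length ≤ u.length + v.length := by
  rcases isShuffle_or_length_lt_of_repr_ne_zero h with h | h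
  · simp [h.perm.length_eq]
  · exact h.le

lemma repr_mul [CommSemigroup S] (u : List S) (y : MixableShuffle k lam S) (z : List S) :
    (wordBasis lam S).repr (word lam u * y) z
      = ((wordBasis lam S).repr y).sum
          fun v r => r * (wordBasis lam S).repr (mulWord lam u v) z := by
  conv_lhs => rw [← (wordBasis lam S).linearCombination_repr y]
  rw [Finsupp.linearCombination_apply, Finsupp.sum, Finset.mul_sum, map_sum,
    Finsupp.finsetSum_apply]
  refine Finset.sum_congr rfl fun v _ => ?_
  rw [mul_smul_comm, wordBasis_apply, word_mul_word, map_smul, Finsupp.smul_apply, smul_eq_mul]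

variable [LinearOrder k] [IsStrictOrderedRing k]

/-- The words of maximal length come from the terms without a factor `lam`, so their coefficients
are non-negative whatever the sign of `lam`. -/
lemma repr_mulWord_nonneg [Mul S] (u v z : List S) (hz : z.length = u.length + v.length) :
    0 ≤ (wordBasis lam S).repr (mulWord lam u v) z := by
  have single_nonneg (w : List S) : 0 ≤ Finsupp.single w (1 : k) z :=
    Finsupp.single_nonneg.2 zero_le_one z
  match u, v with
  | [], v =>
    rw [mulWord, repr_word]
    exact single_nonneg _
  | a :: u, [] =>
    rw [mulWord, repr_word]
    exact single_nonneg _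
  | a :: u, b :: v =>
    cases z with
    | nil => simp at hz
    | cons d z =>
      simp only [List.length_cons] at hz
      have h3 : (wordBasis lam S).repr (cons lam (a * b) (mulWord lam u v)) (d :: z) = 0 := by
        by_contra h
        obtain ⟨w, hw, hw'⟩ := exists_of_repr_cons_ne_zero h
        have := length_le_of_repr_ne_zero hw'
        have := congrArg List.length hw
        simp only [List.length_cons] at this
        omega
      rw [mulWord]
      simp only [map_add, map_smul, Finsupp.add_apply, Finsupp.smul_apply, h3, smul_zero, add_zero]
      refine add_nonneg ?_ ?_
      · by_cases h : a = d
        · rw [h, repr_cons_cons_self]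
          exact repr_mulWord_nonneg u (b :: v) z (by simp only [List.length_cons]; omega)
        · rw [repr_cons_cons_of_ne h]
      · by_cases h : b = d
        · rw [h, repr_cons_cons_self]
          exact repr_mulWord_nonneg (a :: u) v z (by simp only [List.length_cons]; omega)
        · rw [repr_cons_cons_of_ne h]
  termination_by u.length + v.length

lemma repr_mulWord_append_pos [Mul S] (u v : List S) :
    0 < (wordBasis lam S).repr (mulWord lam u v) (u ++ v) := by
  match u, v with
  | [], v =>
    rw [mulWord, repr_word]
    simp
  | a :: u, [] =>
    rw [mulWord, repr_word]
    simp
  | a :: u, b :: v =>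
    have h1 : 0 < (wordBasis lam S).repr (cons lam a (mulWord lam u (b :: v)))
        (a :: (u ++ b :: v)) := by
      rw [repr_cons_cons_self]
      exact repr_mulWord_append_pos u (b :: v)
    have h2 : 0 ≤ (wordBasis lam S).repr (cons lam b (mulWord lam (a :: u) v))
        (a :: (u ++ b :: v)) := by
      by_cases h : b = a
      · subst h
        rw [repr_cons_cons_self]
        exact repr_mulWord_nonneg _ _ _ (by simp only [List.length_append, List.length_cons]; omega)
      · rw [repr_cons_cons_of_ne h]
    have h3 : (wordBasis lam S).repr (cons lam (a * b) (mulWord lam u v))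
        (a :: (u ++ b :: v)) = 0 := by
      by_contra h
      obtain ⟨w, hw, hw'⟩ := exists_of_repr_cons_ne_zero h
      have := length_le_of_repr_ne_zero hw'
      have := congrArg List.length hw
      simp only [List.length_cons, List.length_append] at this
      omega
    rw [mulWord, List.cons_append]
    simp only [map_add, map_smul, Finsupp.add_apply, Finsupp.smul_apply, h3, smul_zero, add_zero]
    exact add_pos_of_pos_of_nonneg h1 h2
  termination_by u.length + v.length

end Coefficients

/-- `IsLower z w`: the word `z` is shorter than `w`, or it is a lexicographically smaller
rearrangement of `w`. -/
def IsLower {S : Type*} [LinearOrder S] (z w : List S) : Prop :=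
  z.length < w.length ∨ (z.Perm w ∧ z < w)

/-- The rank of a word, ordered lexicographically: its length, then the number of its smaller
rearrangements. -/
def wordRank {S : Type*} [LinearOrder S] (w : List S) : ℕ ×ₗ ℕ :=
  toLex (w.length, (w.permutations.toFinset.filter (· < w)).card)

lemma IsLower.wordRank_lt {S : Type*} [LinearOrder S] {z w : List S} (h : IsLower z w) :
    wordRank z < wordRank w := by
  rw [wordRank, wordRank, Prod.Lex.toLex_lt_toLex]
  refine h.imp id fun ⟨hp, hlt⟩ => ⟨hp.length_eq, ?_⟩
  dsimp only
  refine Finset.card_lt_card ?_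
  refine (Finset.ssubset_iff_of_subset fun y hy => ?_).2 ⟨z, ?_, ?_⟩
  · simp only [Finset.mem_filter, List.mem_toFinset, List.mem_permutations] at hy ⊢
    exact ⟨hy.1.trans hp, hy.2.trans hlt⟩
  · simp [hp, hlt]
  · simp

section Leading

variable {k : Type*} [CommRing k] [LinearOrder k] [IsStrictOrderedRing k] {lam : k} {S : Type*}
  [CommSemigroup S] [LinearOrder S]

/-- The product of a non-increasing list of Lyndon words has their concatenation as its leading
word. -/
theorem leading_word_prod {L : List (List S)} (hL : ∀ m ∈ L, IsLyndon m)
    (hs : L.Pairwise (· ≥ ·)) :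
    0 < (wordBasis lam S).repr (L.map (word lam)).prod L.flatten ∧
      ∀ z, (wordBasis lam S).repr (L.map (word lam)).prod z ≠ 0 →
        z = L.flatten ∨ IsLower z L.flatten := by
  induction L with
  | nil =>
    have h1 : (1 : MixableShuffle k lam S) = word lam [] := rfl
    simp only [List.map_nil, List.prod_nil, List.flatten_nil, h1, repr_word]
    refine ⟨by simp, fun z hz => Or.inl ?_⟩
    exact (Finsupp.single_apply_ne_zero.1 hz).1
  | cons l L ih =>
    have hl := hL l (by simp)
    rw [List.pairwise_cons] at hs
    obtain ⟨hpos, hlow⟩ := ih (fun m hm => hL m (by simp [hm])) hs.2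
    rw [List.map_cons, List.prod_cons, List.flatten_cons]
    set y := (L.map (word lam)).prod
    set w := L.flatten with hw
    have bound {x : List S} (hx : IsShuffle l w x) : x ≤ l ++ w := hl.shuffle_le hs.1 hx
    have bound_lt {z x : List S} (hzw : z.Perm w) (hlt : z < w) (hx : IsShuffle l z x) :
        x < l ++ w := by
      obtain ⟨x', hx', hxx'⟩ := hx.exists_gt hzw.length_eq.symm hlt
      exact hxx'.trans_le (bound hx')
    constructor
    · have hlead : (wordBasis lam S).repr (word lam l * y) (l ++ w)
          = (wordBasis lam S).repr y w * (wordBasis lam S).repr (mulWord lam l w) (l ++ w) := by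
        rw [repr_mul, Finsupp.sum,
          Finset.sum_eq_single_of_mem w (Finsupp.mem_support_iff.2 hpos.ne')]
        intro z hz hne
        refine mul_eq_zero_of_right _ ?_
        by_contra h
        have hlen := length_le_of_repr_ne_zero h
        rw [List.length_append] at hlen
        rcases (hlow z (Finsupp.mem_support_iff.1 hz)).resolve_left hne with hz | ⟨hzw, hlt⟩
        · omega
        · rcases isShuffle_or_length_lt_of_repr_ne_zero h with h | h
          · exact lt_irrefl _ (bound_lt hzw hlt h)
          · rw [List.length_append, hzw.length_eq] at h
            omega
      rw [hlead]
      exact mul_pos hpos (repr_mulWord_append_pos l w)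
    · intro x hx
      rw [repr_mul, Finsupp.sum] at hx
      obtain ⟨z, hz, hne⟩ := Finset.exists_ne_zero_of_sum_ne_zero hx
      have hxz := right_ne_zero_of_mul hne
      have hlen := length_le_of_repr_ne_zero hxz
      rcases hlow z (Finsupp.mem_support_iff.1 hz) with rfl | hz | ⟨hzw, hlt⟩
      · rcases isShuffle_or_length_lt_of_repr_ne_zero hxz with h | h
        · exact (eq_or_lt_of_le (bound h)).imp id fun hlt => Or.inr ⟨h.perm, hlt⟩
        · exact Or.inr (Or.inl (by rwa [List.length_append]))
      · exact Or.inr (Or.inl (by rw [List.length_append]; omega))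
      · right
        rcases isShuffle_or_length_lt_of_repr_ne_zero hxz with h | h
        · exact Or.inr ⟨h.perm.trans (hzw.append_left l), bound_lt hzw hlt h⟩
        · exact Or.inl (by rwa [List.length_append, ← hzw.length_eq])

end Leading

end MixableShuffle

/-! ### Monomials in Lyndon words -/

section Monomials

variable {S : Type*} [LinearOrder S]

noncomputable instance : LinearOrder (Lyn S) :=
  inferInstanceAs (LinearOrder {w : List S // IsLyndon w})

/-- The underlying word of a Lyndon word. -/
def Lyn.toWord (l : Lyn S) : List S := l.1

/-- The factors of a monomial in the Lyndon words, as words in non-increasing order. -/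
noncomputable def monomialFactors (m : Lyn S →₀ ℕ) : List (List S) :=
  ((Finsupp.toMultiset m).sort (· ≥ ·)).map Lyn.toWord

lemma isLyndon_of_mem_monomialFactors (m : Lyn S →₀ ℕ) :
    ∀ w ∈ monomialFactors m, IsLyndon w := by
  intro w hw
  obtain ⟨l, -, rfl⟩ := List.mem_map.1 hw
  exact l.2

lemma pairwise_monomialFactors (m : Lyn S →₀ ℕ) : (monomialFactors m).Pairwise (· ≥ ·) :=
  List.pairwise_map.2 (Multiset.pairwise_sort (Finsupp.toMultiset m) (· ≥ ·))

/-- The Chen-Fox-Lyndon theorem: monomials in the Lyndon words correspond to words. -/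
theorem bijective_flatten_monomialFactors :
    Function.Bijective fun m : Lyn S →₀ ℕ => (monomialFactors m).flatten := by
  constructor
  · intro m n h
    have hmn := lyndon_factorization_unique (isLyndon_of_mem_monomialFactors m)
      (pairwise_monomialFactors m) (isLyndon_of_mem_monomialFactors n)
      (pairwise_monomialFactors n) h
    have h' := List.map_injective_iff.2 (fun _ _ h => Subtype.ext h) hmn
    rw [← Finsupp.toMultiset_toFinsupp m, ← Multiset.sort_eq (Finsupp.toMultiset m) (· ≥ ·), h',
      Multiset.sort_eq, Finsupp.toMultiset_toFinsupp]
  · intro w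
    obtain ⟨L, hL, hs, rfl⟩ := exists_lyndon_factorization w
    obtain ⟨L', rfl⟩ : ∃ L' : List (Lyn S), L'.map Lyn.toWord = L :=
      ⟨L.attachWith IsLyndon hL, List.attachWith_map_subtype_val hL⟩
    have hs' : L'.Pairwise (· ≥ ·) := by
      rw [List.pairwise_map] at hs
      exact hs
    refine ⟨Multiset.toFinsupp (L' : Multiset (Lyn S)), ?_⟩
    have hsort : Multiset.sort (L' : Multiset (Lyn S)) (· ≥ ·) = L' := by
      refine List.Perm.eq_of_pairwise' ?_ hs' ?_
      · exact Multiset.pairwise_sort _ _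
      · exact Multiset.coe_eq_coe.1 (Multiset.sort_eq _ _)
    simp only [monomialFactors, Multiset.toFinsupp_toMultiset, hsort]

/-- The order in which `monomialFactors` lists the factors is immaterial for their product. -/
lemma aeval_monomial_eq_prod {A : Type*} [CommRing A] [Algebra ℚ A] (g : List S → A)
    (m : Lyn S →₀ ℕ) :
    MvPolynomial.aeval (fun l : Lyn S => g l.toWord) (MvPolynomial.monomial m (1 : ℚ))
      = ((monomialFactors m).map g).prod := by
  rw [MvPolynomial.aeval_monomial, map_one, one_mul, monomialFactors, List.map_map,
    ← Multiset.prod_coe, ← Multiset.map_coe, Multiset.sort_eq, Finsupp.toMultiset_map,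
    Finsupp.prod_toMultiset, Finsupp.prod_mapDomain_index (by simp) (by simp [pow_add])]
  rfl

end Monomials

/-! ### The polynomial algebra on the Lyndon words -/

theorem mainTheorem6 {S : Type*} [CommSemigroup S] [LinearOrder S] (lam : ℚ) :
    ∃ e : MvPolynomial (Lyn S) ℚ ≃ₐ[ℚ] MixableShuffle ℚ lam S,
      ∀ w : Lyn S, e (MvPolynomial.X w) = MixableShuffle.word lam w.1 := by
  let φ : MvPolynomial (Lyn S) ℚ →ₐ[ℚ] MixableShuffle ℚ lam S :=
    MvPolynomial.aeval fun l : Lyn S => MixableShuffle.word lam l.toWord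
  have hφ (m : Lyn S →₀ ℕ) : φ.toLinearMap (MvPolynomial.basisMonomials (Lyn S) ℚ m)
      = ((monomialFactors m).map (MixableShuffle.word lam)).prod := by
    rw [MvPolynomial.coe_basisMonomials]
    exact aeval_monomial_eq_prod _ m
  have hlead (m : Lyn S →₀ ℕ) := MixableShuffle.leading_word_prod (lam := lam)
    (isLyndon_of_mem_monomialFactors m) (pairwise_monomialFactors m)
  have hbij : Function.Bijective φ.toLinearMap :=
    LinearMap.bijective_of_triangular (MvPolynomial.basisMonomials (Lyn S) ℚ)
      (MixableShuffle.wordBasis lam S) φ.toLinearMap _ bijective_flatten_monomialFactors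
      MixableShuffle.wordRank
      (fun m => by rw [hφ]; exact (hlead m).1.ne')
      (fun m z hz => by
        rw [hφ] at hz
        exact ((hlead m).2 z hz).imp id fun h => h.wordRank_lt)
  exact ⟨AlgEquiv.ofBijective φ hbij, fun w => MvPolynomial.aeval_X _ w⟩
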